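/- There are absolute constants $C>0$ and $k\in\mathbb{N}$ such that the following holds. Let $G=(V,E,\omega)$ be a directed graph on $n$ vertices with positive real edge weights, let $W\ge 1$ be a bound on the ratio between the maximum and the minimum edge weight of $G$, and let $\epsilon\in(0,1)$. Let $\mathrm{dist}_G(u,v)\in[0,\infty]$ denote the weighted distance in $G$, and let $G^{\star}_{\omega}$ be the weighted transitive closure of $G$: the set of all edges $(u,v)$ such that $v$ is reachable from $u$ in $G$, where $(u,v)$ has weight $\mathrm{dist}_G(u,v)$. For a set of weighted edges $H$ on $V$ and a real $\beta\geq 0$, let $\mathrm{dist}^{(\beta)}_{G\cup H}(u,v)$ be the minimum length of a directed $u$-$v$ path in $G\cup H$ with at most $\beta$ edges ($\infty$ if there is none). Then there is a set of weighted edges $H\subseteq G^{\star}_{\omega}$ with $$|H|\le C\,(1+\log n)^{k}\cdot n\,\epsilon^{-2}\log(nW)$$ (that is, $|H|=\widetilde{O}(n\,\epsilon^{-2}\log(nW))$, where $\widetilde{O}$ hides factors polylogarithmic in $n$) such that, for $\beta=n^{2/5}$ and all $u,v\in V$, $$\mathrm{dist}_{G}(u,v)\leq \mathrm{dist}_{G\cup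 H}^{(\beta)}(u,v)\leq (1+\epsilon)\,\mathrm{dist}_{G}(u,v).$$ -/

import Mathlib

open scoped NNReal ENNReal

universe u

/-- A weighted digraph on the vertex set `V`: a digraph with a (nonnegative real) weight for every
edge. The value of `weight` on pairs that are not edges is never used. -/
structure WeightedDigraph (V : Type u) extends Digraph V where
  weight : V → V → ℝ≥0

/-- A weighted edge `(u, v, w)`: an edge from `u` to `v` of weight `w`. -/
abbrev WeightedEdge (V : Type u) : Type u := V × V × ℝ≥0

/-- `IsWalk E u v h ℓ`: the set `E` of weighted edges contains a directed walk from `u` to `v` with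
exactly `h` edges (hops) and total length `ℓ`. The set `E` may hold parallel edges. Dropping cycles
from a walk increases neither its hops nor its length, so walks and simple paths give the same
distances below. -/
inductive IsWalk {V : Type u} (E : Set (WeightedEdge V)) : V → V → ℕ → ℝ≥0 → Prop
  | nil (u : V) : IsWalk E u u 0 0
  | cons {u v x : V} {w ℓ : ℝ≥0} {h : ℕ} (he : (u, v, w) ∈ E) (hp : IsWalk E v x h ℓ) :
      IsWalk E u x (h + 1) (w + ℓ)

/-- The distance from `u` to `v`: the least length of a walk from `u` to `v`, and `∞` if there is
none. -/
noncomputable def walkDist {V : Type u} (E : Set (WeightedEdge V)) (u v : V) : ℝ≥0∞ :=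
  ⨅ (h : ℕ) (ℓ : ℝ≥0) (_ : IsWalk E u v h ℓ), (ℓ : ℝ≥0∞)

/-- The `β`-hop distance from `u` to `v`: the least length of a walk from `u` to `v` with at most
`β` edges, and `∞` if there is none. -/
noncomputable def hopDist {V : Type u} (E : Set (WeightedEdge V)) (β : ℝ) (u v : V) : ℝ≥0∞ :=
  ⨅ (h : ℕ) (ℓ : ℝ≥0) (_ : IsWalk E u v h ℓ) (_ : (h : ℝ) ≤ β), (ℓ : ℝ≥0∞)

namespace WeightedDigraph

variable {V : Type u} (G : WeightedDigraph V)

/-- The set of weighted edges of `G`. -/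
def edges : Set (WeightedEdge V) :=
  {e | G.Adj e.1 e.2.1 ∧ e.2.2 = G.weight e.1 e.2.1}

/-- The distance in `G`. -/
noncomputable def dist (u v : V) : ℝ≥0∞ := walkDist G.edges u v

/-- The weighted transitive closure of `G`: all edges `(u, v)` such that `v` is reachable from `u`
in `G` (that is, the distance is finite), weighted by the distance from `u` to `v` in `G`. -/
def closure : Set (WeightedEdge V) :=
  {e | (e.2.2 : ℝ≥0∞) = G.dist e.1 e.2.1}

/-- `G` is positively weighted. -/
def IsPositive : Prop := ∀ u v, G.Adj u v → 0 < G.weight u v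

/-- The ratio between the weights of any two edges of `G` is at most `W`. -/
def WeightRatioLE (W : ℝ) : Prop :=
  ∀ u v u' v', G.Adj u v → G.Adj u' v' → (G.weight u v : ℝ) ≤ W * G.weight u' v'

/-- The set `H` of weighted edges is a `(β, ε)`-hopset for `G`. -/
def IsHopset (β ε : ℝ) (H : Set (WeightedEdge V)) : Prop :=
  ∀ u v, G.dist u v ≤ hopDist (G.edges ∪ H) β u v ∧
    hopDist (G.edges ∪ H) β u v ≤ ENNReal.ofReal (1 + ε) * G.dist u v

end WeightedDigraph

/-! Distances are split into about `log (nW)` dyadic scales `[D, 2D]`; each scale gets its own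
edges. Let `k ≈ n^(2/5)/13`. A chain is a `k`-element set lying in order on a shortest path of
length `O(D)`.

Shortcuts inside chains. Take a maximal disjoint family `P₁` of chains, then a maximal disjoint
family `P₂` of chains that no chain of `P₁` shortcuts. There are at most `2n/k` chains, and `O(k log
k)` edges per chain link any of its vertices to any later one in two hops (`exists_two_step_pairs`).
Among exact walks using these edges take one with the fewest hops, and suppose that it is long. Of
`3k` of its vertices spaced three hops apart, fewer than `k` miss `P₁` and fewer than `k` miss `P₂`.
Two of the others cannot share both a `P₁`-chain and a `P₂`-chain: each chain must carry them
backwards, since forwards it would save hops, and then the `P₁`-chain shortcuts the `P₂`-chain. So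
the walk meets at least `√k` chains (`exists_chains`).

Jumping across. Greedy hitting sets (`exists_hitting_set`) give a set `S` of about `(n/k) log n`
vertices meeting the first `k` vertices of each long walk, and a set `P'` of about `(n/k^(3/2)) log
n` chains meeting its last part. Each pair from `S × P'` gets `O(ε⁻²)` portal edges
(`exists_portals`). The route follows the walk to `S`, takes a portal to a chain, two hops along it,
and the rest of the walk: `O(k)` hops and additive error at most `εD`. The portals number about
`n²/k^(5/2) · ε⁻²`, which is `O(n ε⁻²)` up to logarithms exactly when `k ≈ n^(2/5)`. -/

/-! ### Walks, distances and hop counts -/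

section Walks

variable {V : Type u} {E F : Set (WeightedEdge V)}

theorem IsWalk.append {x y z : V} {h h' : ℕ} {a b : ℝ≥0} (p : IsWalk E x y h a)
    (q : IsWalk E y z h' b) : IsWalk E x z (h + h') (a + b) := by
  induction p with
  | nil => simpa using q
  | @cons u v x w ℓ h he hp ih =>
    have := IsWalk.cons he (ih q)
    rwa [← add_assoc, add_right_comm] at this

theorem IsWalk.single {x y : V} {w : ℝ≥0} (he : (x, y, w) ∈ E) : IsWalk E x y 1 w := by
  simpa using IsWalk.cons he (IsWalk.nil y)

theorem IsWalk.mono (hEF : E ⊆ F) {x y : V} {h : ℕ} {a : ℝ≥0} (p : IsWalk E x y h a) :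
    IsWalk F x y h a := by
  induction p with
  | nil => exact .nil _
  | cons he _ ih => exact .cons (hEF he) ih

/-- The vertices `z` of a walk, with the length `c i` of its initial segment of `i` hops. -/
theorem IsWalk.exists_seq {x y : V} {h : ℕ} {a : ℝ≥0} (p : IsWalk E x y h a) :
    ∃ (z : ℕ → V) (c : ℕ → ℝ≥0), z 0 = x ∧ z h = y ∧ c 0 = 0 ∧ c h = a ∧
      ∀ i < h, ∃ w, (z i, z (i + 1), w) ∈ E ∧ c (i + 1) = c i + w := by
  induction p with
  | nil u => exact ⟨fun _ => u, fun _ => 0, rfl, rfl, rfl, rfl, by simp⟩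
  | @cons u v x w ℓ h he hp ih =>
    obtain ⟨z, c, z0, zh, c0, ch, hz⟩ := ih
    refine ⟨fun i => i.casesOn u z, fun i => i.casesOn 0 (fun i => w + c i), rfl, zh, rfl,
      by simp [ch], ?_⟩
    rintro (_ | i) hi
    · exact ⟨w, by simpa [z0] using he, by simp [c0]⟩
    · obtain ⟨w', h1, h2⟩ := hz i (by omega)
      exact ⟨w', h1, by simp [h2, add_assoc]⟩

theorem isWalk_of_seq {z : ℕ → V} {c : ℕ → ℝ≥0} {h : ℕ}
    (hz : ∀ i < h, ∃ w, (z i, z (i + 1), w) ∈ E ∧ c (i + 1) = c i + w) {i j : ℕ} (hij : i ≤ j)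
    (hj : j ≤ h) : ∃ b, c i + b = c j ∧ IsWalk E (z i) (z j) (j - i) b := by
  induction j, hij using Nat.le_induction with
  | base => exact ⟨0, by simp, by simpa using IsWalk.nil _⟩
  | succ j hij ih =>
    obtain ⟨b, hb, hw⟩ := ih (by omega)
    obtain ⟨w, he, hc⟩ := hz j (by omega)
    refine ⟨b + w, by rw [hc, ← hb, add_assoc], ?_⟩
    rw [Nat.sub_add_comm hij]
    exact hw.append (.single he)

/-- Cutting out a loop, found by pigeonhole, loses hops and gains no length. Only finitely many
lengths then compete for the distance, so the infimum is attained. -/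
theorem IsWalk.exists_short [Fintype V] {x y : V} {h : ℕ} {a : ℝ≥0} (p : IsWalk E x y h a) :
    ∃ h' < Fintype.card V, ∃ b ≤ a, IsWalk E x y h' b := by
  induction h using Nat.strong_induction_on generalizing a with
  | _ h ih =>
    by_cases hh : h < Fintype.card V
    · exact ⟨h, hh, a, le_rfl, p⟩
    obtain ⟨z, c, z0, zh, c0, ch, hz⟩ := p.exists_seq
    obtain ⟨i, j, hij, hjh, hzz⟩ : ∃ i j, i < j ∧ j ≤ h ∧ z i = z j := by
      obtain ⟨i, j, hne, he⟩ := Fintype.exists_ne_map_eq_of_card_lt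
        (fun i : Fin (h + 1) => z i) (by simp; omega)
      rcases lt_or_gt_of_ne hne with hl | hl
      · exact ⟨i, j, hl, by omega, he⟩
      · exact ⟨j, i, hl, by omega, he.symm⟩
    obtain ⟨b, hb, hw⟩ := isWalk_of_seq hz (Nat.zero_le i) (by omega)
    obtain ⟨b', hb', hw'⟩ := isWalk_of_seq hz hjh le_rfl
    obtain ⟨b'', hb'', -⟩ := isWalk_of_seq hz hij.le hjh
    rw [hzz, z0] at hw
    rw [zh] at hw'
    obtain ⟨h', hh', e, he, hwe⟩ := ih _ (by omega) (hw.append hw')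
    refine ⟨h', hh', e, he.trans ?_, hwe⟩
    rw [← ch, ← hb', ← hb'', ← hb, c0, zero_add]
    gcongr
    exact le_self_add

theorem finite_setOf_isWalk (hE : E.Finite) (x y : V) (h : ℕ) : {a | IsWalk E x y h a}.Finite := by
  induction h generalizing x with
  | zero =>
    refine (Set.finite_singleton 0).subset ?_
    rintro a ha
    cases ha
    rfl
  | succ h ih =>
    refine (hE.biUnion fun e _ => (ih e.2.1).image (e.2.2 + ·)).subset ?_
    rintro a ha
    cases ha with
    | cons he hp => exact Set.mem_biUnion he ⟨_, hp, rfl⟩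

theorem walkDist_le {x y : V} {h : ℕ} {a : ℝ≥0} (p : IsWalk E x y h a) : walkDist E x y ≤ a :=
  iInf_le_of_le h (iInf_le_of_le a (iInf_le _ p))

theorem exists_isWalk_eq_walkDist [Fintype V] (hE : E.Finite) {x y : V} (hd : walkDist E x y ≠ ∞) :
    ∃ h < Fintype.card V, ∃ a : ℝ≥0, IsWalk E x y h a ∧ (a : ℝ≥0∞) = walkDist E x y := by
  set S : Set ℝ≥0 := ⋃ h ∈ Set.Iio (Fintype.card V), {a | IsWalk E x y h a} with hS
  have hfin : S.Finite := (Set.finite_Iio _).biUnion fun h _ => finite_setOf_isWalk hE x y h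
  have hmem : ∀ {a}, a ∈ S ↔ ∃ h < Fintype.card V, IsWalk E x y h a := by
    intro a; simp [hS]
  have hne : S.Nonempty := by
    by_contra hemp
    refine hd ?_
    simp only [walkDist, iInf_eq_top]
    intro h a p
    obtain ⟨h', hh', b, -, q⟩ := p.exists_short
    exact (hemp ⟨b, hmem.2 ⟨h', hh', q⟩⟩).elim
  obtain ⟨a, haS, hmin⟩ := Set.exists_min_image S id hfin hne
  obtain ⟨h, hh, p⟩ := hmem.1 haS
  refine ⟨h, hh, a, p, le_antisymm ?_ (walkDist_le p)⟩
  refine le_iInf fun h' => le_iInf fun b => le_iInf fun q => ?_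
  obtain ⟨h'', hh'', b', hb', q'⟩ := q.exists_short
  exact_mod_cast (hmin b' (hmem.2 ⟨h'', hh'', q'⟩)).trans hb'

theorem walkDist_self (x : V) : walkDist E x x = 0 :=
  le_antisymm (by simpa using walkDist_le (IsWalk.nil (E := E) x)) bot_le

theorem walkDist_triangle [Fintype V] (hE : E.Finite) (x y z : V) :
    walkDist E x z ≤ walkDist E x y + walkDist E y z := by
  by_cases h1 : walkDist E x y = ∞
  · simp [h1]
  by_cases h2 : walkDist E y z = ∞
  · simp [h2]
  obtain ⟨_, -, a, p, ha⟩ := exists_isWalk_eq_walkDist hE h1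
  obtain ⟨_, -, b, q, hb⟩ := exists_isWalk_eq_walkDist hE h2
  rw [← ha, ← hb]
  exact_mod_cast walkDist_le (p.append q)

theorem IsWalk.length_le {w : ℝ≥0} (hw : ∀ e ∈ E, e.2.2 ≤ w) {x y : V} {h : ℕ} {a : ℝ≥0}
    (p : IsWalk E x y h a) : a ≤ h * w := by
  induction p with
  | nil => simp
  | cons he _ ih =>
    have := add_le_add (hw _ he) ih
    rw [Nat.cast_add_one, add_one_mul, add_comm (_ * w)]
    exact this

theorem IsWalk.le_length {w : ℝ≥0} (hw : ∀ e ∈ E, w ≤ e.2.2) {x y : V} {h : ℕ} {a : ℝ≥0}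
    (p : IsWalk E x y h a) (hxy : x ≠ y) : w ≤ a := by
  cases p with
  | nil => exact (hxy rfl).elim
  | cons he _ => exact (hw _ he).trans le_self_add

/-- There is a walk from `x` to `y` with at most `h` hops and length at most `a`. -/
def HasShortWalk (E : Set (WeightedEdge V)) (h : ℕ) (x y : V) (a : ℝ≥0∞) : Prop :=
  ∃ h' ≤ h, ∃ b : ℝ≥0, (b : ℝ≥0∞) ≤ a ∧ IsWalk E x y h' b

theorem IsWalk.hasShortWalk {x y : V} {h : ℕ} {a : ℝ≥0} (p : IsWalk E x y h a) :
    HasShortWalk E h x y a :=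
  ⟨h, le_rfl, a, le_rfl, p⟩

theorem HasShortWalk.trans {x y z : V} {h h' : ℕ} {a b : ℝ≥0∞} (p : HasShortWalk E h x y a)
    (q : HasShortWalk E h' y z b) : HasShortWalk E (h + h') x z (a + b) := by
  obtain ⟨i, hi, a', ha, p⟩ := p
  obtain ⟨j, hj, b', hb, q⟩ := q
  exact ⟨i + j, by omega, a' + b', by push_cast; gcongr, p.append q⟩

theorem HasShortWalk.mono (hEF : E ⊆ F) {x y : V} {h h' : ℕ} {a a' : ℝ≥0∞}
    (p : HasShortWalk E h x y a) (hh : h ≤ h') (ha : a ≤ a') : HasShortWalk F h' x y a' := by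
  obtain ⟨i, hi, b, hb, p⟩ := p
  exact ⟨i, hi.trans hh, b, hb.trans ha, p.mono hEF⟩

theorem HasShortWalk.hopDist_le {x y : V} {h : ℕ} {a : ℝ≥0∞} {β : ℝ} (p : HasShortWalk E h x y a)
    (hβ : (h : ℝ) ≤ β) : hopDist E β x y ≤ a := by
  obtain ⟨i, hi, b, hb, p⟩ := p
  refine le_trans ?_ hb
  exact iInf_le_of_le i (iInf_le_of_le b (iInf_le_of_le p
    (iInf_le _ ((Nat.cast_le.2 hi).trans hβ))))

end Walks

/-! ### Transitive closure edges and exact walks with fewest hops -/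

namespace WeightedDigraph

variable {V : Type u} (G : WeightedDigraph V)

theorem finite_edges [Finite V] : G.edges.Finite := by
  refine (Set.finite_range fun p : V × V => (p.1, p.2, G.weight p.1 p.2)).subset ?_
  rintro ⟨x, y, w⟩ ⟨-, h⟩
  exact ⟨(x, y), by simpa using h.symm⟩

theorem dist_self (x : V) : G.dist x x = 0 := walkDist_self x

theorem dist_triangle [Fintype V] (x y z : V) : G.dist x z ≤ G.dist x y + G.dist y z :=
  walkDist_triangle G.finite_edges x y z

theorem dist_le_of_isWalk [Fintype V] {H : Set (WeightedEdge V)} (hH : H ⊆ G.closure) {x y : V}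
    {h : ℕ} {a : ℝ≥0} (p : IsWalk (G.edges ∪ H) x y h a) : G.dist x y ≤ a := by
  induction p with
  | nil => simp [dist_self]
  | @cons u v x w ℓ h he hp ih =>
    push_cast
    refine (G.dist_triangle u v x).trans (add_le_add ?_ ih)
    rcases he with he | he
    · exact walkDist_le (.single he)
    · exact (hH he).ge

theorem dist_le_hopDist [Fintype V] {H : Set (WeightedEdge V)} (hH : H ⊆ G.closure) (β : ℝ)
    (x y : V) : G.dist x y ≤ hopDist (G.edges ∪ H) β x y :=
  le_iInf fun _ => le_iInf fun _ => le_iInf fun p => le_iInf fun _ => G.dist_le_of_isWalk hH p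

theorem exists_hasShortWalk [Fintype V] {x y : V} (hd : G.dist x y ≠ ∞) :
    ∃ h, HasShortWalk G.edges h x y (G.dist x y) := by
  obtain ⟨h, -, a, p, ha⟩ := exists_isWalk_eq_walkDist G.finite_edges hd
  exact ⟨h, h, le_rfl, a, ha.le, p⟩

theorem dist_pos [Fintype V] (hG : G.IsPositive) {x y : V} (hxy : x ≠ y) : 0 < G.dist x y := by
  by_cases hd : G.dist x y = ∞
  · simp [hd]
  obtain ⟨h, -, a, p, ha⟩ := exists_isWalk_eq_walkDist G.finite_edges hd
  rw [dist, ← ha]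
  cases p with
  | nil => exact (hxy rfl).elim
  | @cons _ v _ w ℓ h he _ =>
    have : 0 < w := by
      have h2 : w = G.weight x v := he.2
      exact h2 ▸ hG _ _ he.1
    exact_mod_cast this.trans_le le_self_add

/-- The edges of the transitive closure over the pairs in `B`. -/
noncomputable def closureEdges [DecidableEq V] (B : Finset (V × V)) : Finset (WeightedEdge V) :=
  B.image fun p => (p.1, p.2, (G.dist p.1 p.2).toNNReal)

theorem closureEdges_subset [DecidableEq V] {B : Finset (V × V)}
    (hB : ∀ p ∈ B, G.dist p.1 p.2 ≠ ∞) :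
    (G.closureEdges B : Set (WeightedEdge V)) ⊆ G.closure := by
  intro e he
  simp only [closureEdges, Finset.coe_image, Set.mem_image] at he
  obtain ⟨p, hp, rfl⟩ := he
  exact ENNReal.coe_toNNReal (hB p hp)

theorem hasShortWalk_closureEdges [DecidableEq V] {B : Finset (V × V)} {x y : V}
    (hxy : (x, y) ∈ B) : HasShortWalk (G.closureEdges B : Set (WeightedEdge V)) 1 x y
      (G.dist x y) :=
  ⟨1, le_rfl, _, ENNReal.coe_toNNReal_le_self, .single (Finset.mem_coe.2
    (Finset.mem_image_of_mem _ hxy))⟩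

/-- `z 0, …, z m` are the vertices of a walk from `u` to `v` in `G` and `H` that is exact and, among
the exact walks, has the fewest hops; so are its segments. -/
def IsMinimalWalk (H : Set (WeightedEdge V)) (u v : V) (m : ℕ) (z : ℕ → V) : Prop :=
  z 0 = u ∧ z m = v ∧
    ∀ i j, i ≤ j → j ≤ m → G.dist u (z i) + G.dist (z i) (z j) = G.dist u (z j) ∧
      G.dist u (z j) + G.dist (z j) v = G.dist u v ∧
      HasShortWalk (G.edges ∪ H) (j - i) (z i) (z j) (G.dist (z i) (z j)) ∧
      ∀ h, HasShortWalk (G.edges ∪ H) h (z i) (z j) (G.dist (z i) (z j)) → j - i ≤ h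

theorem exists_isMinimalWalk [Fintype V] {H : Set (WeightedEdge V)} (hH : H ⊆ G.closure) {u v : V}
    (hd : G.dist u v ≠ ∞) : ∃ (m : ℕ) (z : ℕ → V), G.IsMinimalWalk H u v m z := by
  classical
  have hex : ∃ h, HasShortWalk (G.edges ∪ H) h u v (G.dist u v) := by
    obtain ⟨h, p⟩ := G.exists_hasShortWalk hd
    exact ⟨h, p.mono Set.subset_union_left le_rfl le_rfl⟩
  have hmin := fun h => Nat.find_min' (m := h) hex
  obtain ⟨m, hm, a, ha, p⟩ := Nat.find_spec hex
  have hm' : m = Nat.find hex := le_antisymm hm (hmin _ ⟨m, le_rfl, a, ha, p⟩)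
  rw [← hm'] at hmin
  have hau : (a : ℝ≥0∞) = G.dist u v := le_antisymm ha (G.dist_le_of_isWalk hH p)
  obtain ⟨z, c, z0, zm, c0, cm, hz⟩ := p.exists_seq
  refine ⟨m, z, z0, zm, fun i j hij hj => ?_⟩
  obtain ⟨b1, hb1, p1⟩ := isWalk_of_seq hz (Nat.zero_le i) (hij.trans hj)
  obtain ⟨b2, hb2, p2⟩ := isWalk_of_seq hz hij hj
  obtain ⟨b3, hb3, p3⟩ := isWalk_of_seq hz hj le_rfl
  rw [z0] at p1
  rw [zm] at p3
  have d1 := G.dist_le_of_isWalk hH p1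
  have d2 := G.dist_le_of_isWalk hH p2
  have d3 := G.dist_le_of_isWalk hH p3
  have t1 := G.dist_triangle u (z i) (z j)
  have t2 := G.dist_triangle u (z j) v
  have hsum : G.dist u v = b1 + b2 + b3 := by
    rw [← hau, ← cm, ← hb3, ← hb2, ← hb1, c0, zero_add]
    push_cast
    rfl
  lift G.dist u (z i) to ℝ≥0 using ne_top_of_le_ne_top ENNReal.coe_ne_top d1 with e1 he1
  -- The three segment lengths bound the distances from above and add up to `G.dist u v`; the
  -- triangle inequalities leave no slack, so each segment is exact.
  have hkey : G.dist (z i) (z j) = b2 ∧ (e1 : ℝ≥0∞) = b1 ∧ G.dist (z j) v = b3 ∧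
      G.dist u (z j) = b1 + b2 := by
    generalize G.dist (z i) (z j) = D2 at *
    generalize G.dist (z j) v = D3 at *
    generalize G.dist u (z j) = D4 at *
    lift D2 to ℝ≥0 using ne_top_of_le_ne_top ENNReal.coe_ne_top d2
    lift D3 to ℝ≥0 using ne_top_of_le_ne_top ENNReal.coe_ne_top d3
    lift D4 to ℝ≥0 using ne_top_of_le_ne_top (by finiteness) t1
    rw [hsum] at t2
    norm_cast at *
    rw [← NNReal.coe_le_coe] at d1 d2 d3 t1 t2
    simp only [← NNReal.coe_inj]
    push_cast at *
    refine ⟨?_, ?_, ?_, ?_⟩ <;> linarith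
  obtain ⟨k1, k2, k3, k4⟩ := hkey
  refine ⟨by rw [k1, k2, k4], by rw [k3, k4, hsum], by rw [k1]; exact p2.hasShortWalk, ?_⟩
  intro h q
  rw [k1] at q
  -- Splicing a walk with fewer hops into the middle would beat the minimum `m`.
  have := hmin _ ((p1.hasShortWalk.trans q).trans p3.hasShortWalk |>.mono subset_rfl le_rfl
    hsum.ge)
  omega

end WeightedDigraph

/-! ### Hitting sets, two-step shortcuts and packings of chains -/

section Combinatorics

/-- A family of at most `N` sets, each with at least `T` of the elements of `U`, has a small
hitting set. -/
theorem exists_hitting_set {α ι : Type*} [DecidableEq α] (U : Finset α) (I : Finset ι)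
    (F : ι → Finset α) (hF : ∀ i ∈ I, F i ⊆ U) {T N : ℝ} (hT : 0 < T)
    (hcard : ∀ i ∈ I, T ≤ (F i).card) (hN : 1 ≤ N) (hI : (I.card : ℝ) ≤ N) :
    ∃ S ⊆ U, (S.card : ℝ) ≤ U.card / T * Real.log N + 1 ∧ ∀ i ∈ I, ¬ Disjoint (F i) S := by
  classical
  rcases I.eq_empty_or_nonempty with rfl | ⟨i₀, hi₀⟩
  · have := Real.log_nonneg hN
    exact ⟨∅, by simp, by simp; positivity, by simp⟩
  have hU0 : (0 : ℝ) < U.card :=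
    hT.trans_le ((hcard _ hi₀).trans (by exact_mod_cast Finset.card_le_card (hF _ hi₀)))
  -- Greedy choice: each new element cuts the number of unhit sets by a factor `1 - T/|U| ≤
  -- exp(-T/|U|)`.
  have step : ∀ r : ℕ, ∃ S ⊆ U, S.card ≤ r ∧
      ((I.filter fun i => Disjoint (F i) S).card : ℝ) ≤ N * Real.exp (-(T / U.card) * r) := by
    intro r
    induction r with
    | zero => exact ⟨∅, by simp, by simp, by simpa using hI⟩
    | succ r ih =>
      obtain ⟨S, hSU, hSr, hS⟩ := ih
      set J := I.filter fun i => Disjoint (F i) S with hJ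
      -- Averaging: by double counting, some element lies in at least a fraction `T/|U|` of the
      -- unhit sets.
      obtain ⟨x, hx, hxJ⟩ : ∃ x ∈ U, T / U.card * J.card ≤
          ((J.filter fun i => x ∈ F i).card : ℝ) := by
        by_contra! hlt
        have h1 : ∑ x ∈ U, ((J.filter fun i => x ∈ F i).card : ℝ) <
            ∑ x ∈ U, T / U.card * J.card :=
          Finset.sum_lt_sum_of_nonempty (Finset.card_pos.1 (by exact_mod_cast hU0)) hlt
        have h2 : ∑ x ∈ U, (J.filter fun i => x ∈ F i).card = ∑ i ∈ J, (F i).card := by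
          simp only [Finset.card_filter]
          rw [Finset.sum_comm]
          refine Finset.sum_congr rfl fun i hi => ?_
          rw [← Finset.card_filter, Finset.filter_mem_eq_inter,
            Finset.inter_eq_right.2 (hF i (Finset.mem_filter.1 hi).1)]
        have h3 : (J.card : ℝ) * T ≤ ∑ i ∈ J, ((F i).card : ℝ) := by
          rw [← nsmul_eq_mul]
          exact Finset.card_nsmul_le_sum _ _ _ fun i hi => hcard i (Finset.mem_filter.1 hi).1
        rw [Finset.sum_const, nsmul_eq_mul] at h1
        have h4 : (U.card : ℝ) * (T / U.card * J.card) = J.card * T := by field_simp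
        have h5 : ∑ x ∈ U, ((J.filter fun i => x ∈ F i).card : ℝ) =
          ∑ i ∈ J, ((F i).card : ℝ) := by exact_mod_cast h2
        linarith
      refine ⟨insert x S, Finset.insert_subset hx hSU, (Finset.card_insert_le _ _).trans
        (by omega), ?_⟩
      have h6 : (I.filter fun i => Disjoint (F i) (insert x S)) = J.filter fun i => x ∉ F i := by
        ext i
        simp only [hJ, Finset.mem_filter, Finset.disjoint_insert_right]
        tauto
      have h7 : ((J.filter fun i => x ∈ F i).card : ℝ) + (J.filter fun i => x ∉ F i).card =
        J.card := by exact_mod_cast Finset.card_filter_add_card_filter_not (s := J) (x ∈ F ·)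
      have h8 : 1 - T / U.card ≤ Real.exp (-(T / U.card)) := Real.one_sub_le_exp_neg _
      calc ((I.filter fun i => Disjoint (F i) (insert x S)).card : ℝ)
          ≤ (1 - T / U.card) * J.card := by rw [h6]; linarith
        _ ≤ Real.exp (-(T / U.card)) * (N * Real.exp (-(T / U.card) * r)) := by gcongr
        _ = N * Real.exp (-(T / U.card) * (r + 1 : ℕ)) := by
          push_cast
          rw [mul_add, mul_one, Real.exp_add]
          ring
  have hlog := Real.log_nonneg hN
  -- More than `(|U|/T) log N` choices leave fewer than one set unhit, hence none.
  obtain ⟨S, hSU, hSr, hS⟩ := step (⌊U.card / T * Real.log N⌋₊ + 1)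
  refine ⟨S, hSU, ?_, fun i hi hd => ?_⟩
  · refine (Nat.cast_le.2 hSr).trans ?_
    push_cast
    gcongr
    exact Nat.floor_le (by positivity)
  · have h1 : (1 : ℝ) ≤ (I.filter fun i => Disjoint (F i) S).card := by
      exact_mod_cast Finset.card_pos.2 ⟨i, Finset.mem_filter.2 ⟨hi, hd⟩⟩
    have h2 : N * Real.exp (-(T / U.card) * (⌊U.card / T * Real.log N⌋₊ + 1 : ℕ)) < 1 := by
      have h3 : Real.log N < T / U.card * (⌊U.card / T * Real.log N⌋₊ + 1 : ℕ) := by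
        have := Nat.lt_floor_add_one (U.card / T * Real.log N)
        push_cast
        calc Real.log N = T / U.card * (U.card / T * Real.log N) := by field_simp
          _ < _ := by gcongr
      calc _ < N * Real.exp (- Real.log N) := by
            gcongr
            linarith
        _ = 1 := by rw [Real.exp_neg, Real.exp_log (by linarith)]; field_simp
    linarith

/-- A finite set has an initial segment of every possible size. -/
theorem exists_initial_segment {α β : Type*} [LinearOrder β] [DecidableEq α] (f : α → β)
    (C : Finset α) {j : ℕ} (hj : j ≤ C.card) :
    ∃ L ⊆ C, L.card = j ∧ ∀ x ∈ L, ∀ y ∈ C \ L, f x ≤ f y := by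
  induction j with
  | zero => exact ⟨∅, by simp⟩
  | succ j ih =>
    obtain ⟨L, hL, hLj, hle⟩ := ih (by omega)
    have hne : (C \ L).Nonempty := by
      rw [← Finset.card_pos, Finset.card_sdiff_of_subset hL]
      omega
    obtain ⟨a, ha, hmin⟩ := Finset.exists_min_image (C \ L) f hne
    rw [Finset.mem_sdiff] at ha
    refine ⟨insert a L, Finset.insert_subset ha.1 hL, by
      rw [Finset.card_insert_of_notMem ha.2, hLj], fun x hx y hy => ?_⟩
    have hy' : y ∈ C \ L := by
      simp only [Finset.mem_sdiff, Finset.mem_insert, not_or] at hy ⊢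
      tauto
    rcases Finset.mem_insert.1 hx with rfl | hx
    · exact hmin y hy'
    · exact hle x hx y hy'

/-- A chain of `c ≤ 2 ^ t` elements has `t * c` pairs through which each of its elements is linked
to each later one in two steps. -/
theorem exists_two_step_pairs {α β : Type*} [LinearOrder β] [DecidableEq α] (f : α → β)
    (t : ℕ) (C : Finset α) (hC : C.card ≤ 2 ^ t) :
    ∃ B : Finset (α × α), B.card ≤ t * C.card ∧
      (∀ p ∈ B, p.1 ∈ C ∧ p.2 ∈ C ∧ f p.1 ≤ f p.2) ∧
      ∀ x ∈ C, ∀ y ∈ C, f x < f y → ∃ z ∈ C, f x ≤ f z ∧ f z ≤ f y ∧ (x, z) ∈ B ∧ (z, y) ∈ B := by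
  induction t generalizing C with
  | zero =>
    refine ⟨∅, by simp, by simp, fun x hx y hy hxy => ?_⟩
    rw [pow_zero, Finset.card_le_one] at hC
    exact absurd hxy (by rw [hC x hx y hy]; exact lt_irrefl _)
  | succ t ih =>
    rcases C.eq_empty_or_nonempty with rfl | hne
    · exact ⟨∅, by simp⟩
    have hpos := hne.card_pos
    rw [pow_succ] at hC
    -- Rounding up keeps the lower half nonempty, so that it has a last element `z`, a median. Pairs
    -- separated by the split go through `z`; the others are left to the recursion.
    obtain ⟨L, hL, hLj, hle⟩ := exists_initial_segment f C (j := (C.card + 1) / 2) (by omega)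
    have hLU := Finset.card_sdiff_add_card_eq_card hL
    obtain ⟨z, hz, hmax⟩ := Finset.exists_max_image L f (Finset.card_pos.1 (by omega))
    obtain ⟨B₁, hB₁, hs₁, hl₁⟩ := ih L (by omega)
    obtain ⟨B₂, hB₂, hs₂, hl₂⟩ := ih (C \ L) (by omega)
    refine ⟨B₁ ∪ B₂ ∪ L.image (·, z) ∪ (C \ L).image (z, ·), ?_, ?_, ?_⟩
    · calc _ ≤ B₁.card + B₂.card + L.card + (C \ L).card := by
            refine (Finset.card_union_le _ _).trans (add_le_add ?_ Finset.card_image_le)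
            refine (Finset.card_union_le _ _).trans (add_le_add ?_ Finset.card_image_le)
            exact Finset.card_union_le _ _
        _ ≤ t * L.card + t * (C \ L).card + L.card + (C \ L).card := by gcongr
        _ = (t + 1) * C.card := by rw [← hLU]; ring
    · intro p hp
      simp only [Finset.mem_union, Finset.mem_image] at hp
      rcases hp with ((hp | hp) | ⟨x, hx, rfl⟩) | ⟨y, hy, rfl⟩
      · obtain ⟨h1, h2, h3⟩ := hs₁ p hp
        exact ⟨hL h1, hL h2, h3⟩
      · obtain ⟨h1, h2, h3⟩ := hs₂ p hp
        exact ⟨(Finset.mem_sdiff.1 h1).1, (Finset.mem_sdiff.1 h2).1, h3⟩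
      · exact ⟨hL hx, hL hz, hmax x hx⟩
      · exact ⟨hL hz, (Finset.mem_sdiff.1 hy).1, hle z hz y hy⟩
    · intro x hx y hy hxy
      simp only [Finset.mem_union, Finset.mem_image]
      by_cases hxL : x ∈ L <;> by_cases hyL : y ∈ L
      · obtain ⟨w, hw, h1, h2, h3, h4⟩ := hl₁ x hxL y hyL hxy
        exact ⟨w, hL hw, h1, h2, by tauto, by tauto⟩
      · have hy' := Finset.mem_sdiff.2 ⟨hy, hyL⟩
        exact ⟨z, hL hz, hmax x hxL, hle z hz y hy', .inl (.inr ⟨x, hxL, rfl⟩),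
          .inr ⟨y, hy', rfl⟩⟩
      · exact absurd hxy (hle y hyL x (Finset.mem_sdiff.2 ⟨hx, hxL⟩)).not_gt
      · obtain ⟨w, hw, h1, h2, h3, h4⟩ := hl₂ x (Finset.mem_sdiff.2 ⟨hx, hxL⟩) y
          (Finset.mem_sdiff.2 ⟨hy, hyL⟩) hxy
        exact ⟨w, (Finset.mem_sdiff.1 hw).1, h1, h2, by tauto, by tauto⟩

/-- The vertices covered by a family of rooted vertex sets. -/
def covered {V : Type u} [DecidableEq V] (P : Finset (V × Finset V)) : Finset V := P.biUnion Prod.snd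

/-- A maximal family of disjoint `k`-element sets with a hereditary property: few elements of a set
with the property are left uncovered. -/
theorem exists_packing {V : Type u} [Fintype V] [DecidableEq V] (p : V × Finset V → Prop)
    (hp : ∀ u X Y, Y ⊆ X → p (u, X) → p (u, Y)) {k : ℕ} (hk : 0 < k) :
    ∃ P : Finset (V × Finset V), (∀ c ∈ P, p c ∧ c.2.card = k) ∧ P.card * k ≤ Fintype.card V ∧
      ∀ u X, p (u, X) → (X \ covered P).card < k := by
  classical
  let Q : Finset (Finset (V × Finset V)) := Finset.univ.filter fun P =>
    (∀ c ∈ P, p c ∧ c.2.card = k) ∧ (P : Set (V × Finset V)).PairwiseDisjoint Prod.snd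
  obtain ⟨P, hP, hmax⟩ := Finset.exists_max_image Q Finset.card ⟨∅, by simp [Q]⟩
  obtain ⟨hPp, hPd⟩ := (Finset.mem_filter.1 hP).2
  refine ⟨P, hPp, ?_, fun u X hX => ?_⟩
  · calc P.card * k = ∑ c ∈ P, c.2.card := by
          rw [Finset.sum_congr rfl fun c hc => (hPp c hc).2, Finset.sum_const, smul_eq_mul]
      _ = (P.biUnion Prod.snd).card := (Finset.card_biUnion hPd).symm
      _ ≤ _ := Finset.card_le_univ _
  · by_contra! hlt
    obtain ⟨Y, hY, hYk⟩ := Finset.exists_subset_card_eq hlt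
    have hdisj : ∀ c ∈ P, Disjoint Y c.2 := fun c hc =>
      Finset.disjoint_of_subset_left hY (Finset.disjoint_of_subset_right
        (Finset.subset_biUnion_of_mem Prod.snd hc) Finset.sdiff_disjoint)
    -- Here `0 < k` matters: an empty set would be disjoint from itself.
    have hnot : (u, Y) ∉ P := fun hmem => by
      have := hdisj _ hmem
      rw [disjoint_self, Finset.bot_eq_empty] at this
      rw [this] at hYk
      simp at hYk
      omega
    have hins : insert (u, Y) P ∈ Q := by
      refine Finset.mem_filter.2 ⟨Finset.mem_univ _, ?_, ?_⟩
      · intro c hc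
        rcases Finset.mem_insert.1 hc with rfl | hc
        · exact ⟨hp u X Y (hY.trans Finset.sdiff_subset) hX, hYk⟩
        · exact hPp c hc
      · rw [Finset.coe_insert]
        exact hPd.insert fun c hc _ => hdisj c hc
    have := hmax _ hins
    rw [Finset.card_insert_of_notMem hnot] at this
    omega

/-- Some chain of `P` leads from `x` to `y`. -/
def ChainBefore {V : Type u} (d : V → V → ℝ≥0∞) (P : Finset (V × Finset V)) (x y : V) : Prop :=
  ∃ c ∈ P, x ∈ c.2 ∧ y ∈ c.2 ∧ d c.1 x < d c.1 y

/-- A path that no chain shortcuts, each of whose vertices is on a chain of `P₁` and on a chain of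
`P₂`, meets many chains if no chain of `P₁` shortcuts a chain of `P₂`. -/
theorem card_le_sq_card_touched {V : Type u} [DecidableEq V] (d : V → V → ℝ≥0∞)
    {P₁ P₂ : Finset (V × Finset V)} {u : V} {Y : Finset V}
    (h₁ : Y ⊆ covered P₁) (h₂ : Y ⊆ covered P₂)
    (hfree : ∀ x ∈ Y, ∀ y ∈ Y, d u x < d u y → ¬ ChainBefore d (P₁ ∪ P₂) x y)
    (hfree' : ∀ c ∈ P₂, ∀ x ∈ c.2, ∀ y ∈ c.2, d c.1 x < d c.1 y → ¬ ChainBefore d P₁ x y)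
    (hinj : ∀ c ∈ P₁ ∪ P₂, ∀ x ∈ c.2, ∀ y ∈ c.2, d c.1 x = d c.1 y → x = y)
    (hY : ∀ x ∈ Y, ∀ y ∈ Y, d u x = d u y → x = y) :
    Y.card ≤ ((P₁ ∪ P₂).filter fun c => ¬ Disjoint c.2 Y).card ^ 2 := by
  -- A chain through two vertices of the path runs through them backwards, for otherwise it would
  -- shortcut the path.
  have key : ∀ c ∈ P₁ ∪ P₂, ∀ x ∈ Y, ∀ y ∈ Y, d u x < d u y → x ∈ c.2 → y ∈ c.2 →
      d c.1 y < d c.1 x := by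
    intro c hc x hx y hy hxy hxc hyc
    refine lt_of_le_of_ne (le_of_not_gt fun hlt => hfree x hx y hy hxy ⟨c, hc, hxc, hyc, hlt⟩) ?_
    intro he
    rw [hinj c hc y hyc x hxc he] at hxy
    exact lt_irrefl _ hxy
  -- If both chains carry `x` and `y` backwards, they agree with each other, so `c₁` shortcuts `c₂`,
  -- which is excluded. A vertex of `Y` is thus determined by its pair of chains.
  have hno : ∀ c₁ ∈ P₁, ∀ c₂ ∈ P₂, ∀ x ∈ Y, ∀ y ∈ Y, x ∈ c₁.2 → y ∈ c₁.2 → x ∈ c₂.2 → y ∈ c₂.2 →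
      ¬ d u x < d u y := by
    intro c₁ hc₁ c₂ hc₂ x hx y hy hx1 hy1 hx2 hy2 hlt
    exact hfree' c₂ hc₂ y hy2 x hx2
      (key c₂ (Finset.mem_union_right _ hc₂) x hx y hy hlt hx2 hy2)
      ⟨c₁, hc₁, hy1, hx1, key c₁ (Finset.mem_union_left _ hc₁) x hx y hy hlt hx1 hy1⟩
  have h₁' : ∀ y ∈ Y, ∃ c ∈ P₁, y ∈ c.2 := fun y hy => Finset.mem_biUnion.1 (h₁ hy)
  have h₂' : ∀ y ∈ Y, ∃ c ∈ P₂, y ∈ c.2 := fun y hy => Finset.mem_biUnion.1 (h₂ hy)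
  choose! f hf hf' using h₁'
  choose! g hg hg' using h₂'
  rw [sq, ← Finset.card_product]
  refine Finset.card_le_card_of_injOn (fun y => (f y, g y)) ?_ ?_
  · intro y hy
    rw [Finset.mem_coe] at hy
    simp only [Finset.coe_product, Set.mem_prod, Finset.mem_coe, Finset.mem_filter]
    refine ⟨⟨Finset.mem_union_left _ (hf y hy), ?_⟩, ⟨Finset.mem_union_right _ (hg y hy), ?_⟩⟩
    · exact Finset.not_disjoint_iff.2 ⟨y, hf' y hy, hy⟩
    · exact Finset.not_disjoint_iff.2 ⟨y, hg' y hy, hy⟩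
  · intro x hx y hy hxy
    rw [Finset.mem_coe] at hx hy
    obtain ⟨e1, e2⟩ := Prod.mk.inj hxy
    have hy1 := hf' y hy
    have hy2 := hg' y hy
    rw [← e1] at hy1
    rw [← e2] at hy2
    refine hY x hx y hy (le_antisymm (le_of_not_gt ?_) (le_of_not_gt ?_))
    · exact hno _ (hf x hx) _ (hg x hx) y hy x hx hy1 (hf' x hx) hy2 (hg' x hx)
    · exact hno _ (hf x hx) _ (hg x hx) x hx y hy (hf' x hx) hy1 (hg' x hx) hy2

end Combinatorics

/-! ### Geodesic sets, chains and portals -/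

section Geodesic

/-- The vertices of `c.2` lie, in the order of their distance from `c.1`, on a shortest path, within
distance `D` from `c.1`. -/
def IsGeodesicSet {V : Type u} (d : V → V → ℝ≥0∞) (D : ℝ≥0) (c : V × Finset V) : Prop :=
  (∀ x ∈ c.2, d c.1 x ≤ D) ∧
    ∀ x ∈ c.2, ∀ y ∈ c.2, d c.1 x ≤ d c.1 y → d c.1 x + d x y = d c.1 y

theorem IsGeodesicSet.mono {V : Type u} {d : V → V → ℝ≥0∞} {D : ℝ≥0} {u : V} {X Y : Finset V}
    (hXY : Y ⊆ X) (h : IsGeodesicSet d D (u, X)) : IsGeodesicSet d D (u, Y) :=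
  ⟨fun x hx => h.1 x (hXY hx), fun x hx y hy => h.2 x (hXY hx) y (hXY hy)⟩

theorem IsGeodesicSet.dist_add {V : Type u} {d : V → V → ℝ≥0∞} {D : ℝ≥0} {c : V × Finset V}
    (h : IsGeodesicSet d D c) {x y z : V} (hx : x ∈ c.2) (hy : y ∈ c.2) (hz : z ∈ c.2)
    (hxz : d c.1 x ≤ d c.1 z) (hzy : d c.1 z ≤ d c.1 y) : d x z + d z y = d x y := by
  have h1 := h.2 x hx z hz hxz
  have h2 := h.2 z hz y hy hzy
  have h3 := h.2 x hx y hy (hxz.trans hzy)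
  rw [← h3, ← h1, add_assoc] at h2
  exact (ENNReal.add_right_inj (ne_top_of_le_ne_top ENNReal.coe_ne_top (h.1 x hx))).1 h2

theorem IsGeodesicSet.injOn {V : Type u} {d : V → V → ℝ≥0∞} {D : ℝ≥0} {c : V × Finset V}
    (h : IsGeodesicSet d D c) (hpos : ∀ x y, d x y = 0 → x = y) :
    ∀ x ∈ c.2, ∀ y ∈ c.2, d c.1 x = d c.1 y → x = y := by
  intro x hx y hy hxy
  have h1 := h.2 x hx y hy hxy.le
  rw [← hxy] at h1
  refine hpos x y ((ENNReal.add_right_inj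
    (ne_top_of_le_ne_top ENNReal.coe_ne_top (h.1 x hx))).1 ?_)
  rw [h1, add_zero]

/-- A small family of chains such that every path that they do not shortcut meets many of them. -/
theorem exists_chains {V : Type u} [Fintype V] [DecidableEq V] (d : V → V → ℝ≥0∞)
    (hpos : ∀ x y, d x y = 0 → x = y) (D : ℝ≥0) {k : ℕ} (hk : 0 < k) :
    ∃ P : Finset (V × Finset V), (∀ c ∈ P, IsGeodesicSet d D c) ∧ (∀ c ∈ P, c.2.card = k) ∧
      P.card * k ≤ 2 * Fintype.card V ∧
      ∀ u Y, IsGeodesicSet d D (u, Y) → 3 * k ≤ Y.card →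
        (∀ x ∈ Y, ∀ y ∈ Y, d u x < d u y → ¬ ChainBefore d P x y) →
        k ≤ (P.filter fun c => ¬ Disjoint c.2 Y).card ^ 2 := by
  obtain ⟨P₁, hP₁, hc₁, hu₁⟩ := exists_packing (IsGeodesicSet d D)
    (fun u X Y hYX h => h.mono hYX) hk
  obtain ⟨P₂, hP₂, hc₂, hu₂⟩ := exists_packing
    (fun c => IsGeodesicSet d D c ∧
      ∀ x ∈ c.2, ∀ y ∈ c.2, d c.1 x < d c.1 y → ¬ ChainBefore d P₁ x y)
    (fun u X Y hYX h => ⟨h.1.mono hYX, fun x hx y hy => h.2 x (hYX hx) y (hYX hy)⟩) hk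
  have hgeo : ∀ c ∈ P₁ ∪ P₂, IsGeodesicSet d D c := fun c hc =>
    (Finset.mem_union.1 hc).elim (fun h => (hP₁ c h).1) (fun h => (hP₂ c h).1.1)
  refine ⟨P₁ ∪ P₂, hgeo, fun c hc => (Finset.mem_union.1 hc).elim (fun h => (hP₁ c h).2)
    (fun h => (hP₂ c h).2), ?_, fun u Y hY hYk hfree => ?_⟩
  · have := Nat.mul_le_mul_right k (Finset.card_union_le P₁ P₂)
    rw [add_mul] at this
    omega
  · have hfree₁ : ∀ x ∈ Y, ∀ y ∈ Y, d u x < d u y → ¬ ChainBefore d P₁ x y :=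
      fun x hx y hy hxy ⟨c, hc, h⟩ => hfree x hx y hy hxy ⟨c, Finset.mem_union_left _ hc, h⟩
    have n₁ := hu₁ u Y hY
    have n₂ := hu₂ u Y ⟨hY, hfree₁⟩
    set Z := Y ∩ covered P₁ ∩ covered P₂ with hZ
    have hZY : Z ⊆ Y := Finset.inter_subset_left.trans Finset.inter_subset_left
    -- Each packing leaves fewer than `k` vertices of `Y` uncovered; from `3 * k`, at least `k` are
    -- covered by both.
    have hcard : Y.card ≤ Z.card + (Y \ covered P₁).card + (Y \ covered P₂).card := by
      refine (Finset.card_le_card (t := Z ∪ (Y \ covered P₁) ∪ (Y \ covered P₂)) ?_).trans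
        ((Finset.card_union_le _ _).trans (Nat.add_le_add_right (Finset.card_union_le _ _) _))
      intro y hy
      simp only [hZ, Finset.mem_union, Finset.mem_inter, Finset.mem_sdiff]
      tauto
    have hmain := card_le_sq_card_touched d (P₁ := P₁) (P₂ := P₂) (u := u) (Y := Z)
      (fun y hy => (Finset.mem_inter.1 (Finset.mem_inter.1 hy).1).2)
      (fun y hy => (Finset.mem_inter.1 hy).2)
      (fun x hx y hy => hfree x (hZY hx) y (hZY hy))
      (fun c hc => (hP₂ c hc).1.2)
      (fun c hc => (hgeo c hc).injOn hpos)
      ((hY.mono hZY).injOn hpos)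
    calc k ≤ Z.card := by omega
      _ ≤ _ := hmain
      _ ≤ _ := Nat.pow_le_pow_left (Finset.card_le_card fun c hc => by
        rw [Finset.mem_filter] at hc ⊢
        exact ⟨hc.1, fun h => hc.2 (Finset.disjoint_of_subset_right hZY h)⟩) 2

/-- Portals: from a vertex of `S` one reaches any vertex of a chain of `P`, up to an additive error,
by one edge to an earlier vertex of the chain that is close to it. -/
theorem exists_portals {V : Type u} [DecidableEq V] (d : V → V → ℝ≥0∞) (D δ : ℝ≥0)
    (hδ : 0 < δ) (S : Finset V) (P : Finset (V × Finset V)) (hP : ∀ c ∈ P, IsGeodesicSet d D c) :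
    ∃ B : Finset (V × V), B.card ≤ S.card * P.card * (⌊D / δ⌋₊ + 1) ^ 2 ∧
      (∀ p ∈ B, d p.1 p.2 ≠ ∞) ∧
      ∀ s ∈ S, ∀ c ∈ P, ∀ y ∈ c.2, d s y ≤ D →
        ∃ x ∈ c.2, d c.1 x ≤ d c.1 y ∧ (s, x) ∈ B ∧ d s x ≤ d s y + δ ∧ d x y ≤ δ := by
  classical
  -- Distances are rounded down to multiples of `δ`. Vertices of a chain are classified by their
  -- rounded distances from the root and from `s`, and the portal of a class is its earliest vertex.
  let r : V → V → ℕ := fun x y => ⌊(d x y).toNNReal / δ⌋₊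
  have hr : ∀ {a b a' b'}, d a b ≤ D → d a' b' ≤ D → r a b = r a' b' → d a b ≤ d a' b' + δ := by
    intro a b a' b' h h' he
    simp only [r] at he
    lift d a b to ℝ≥0 using ne_top_of_le_ne_top ENNReal.coe_ne_top h with p
    lift d a' b' to ℝ≥0 using ne_top_of_le_ne_top ENNReal.coe_ne_top h' with q
    simp only [ENNReal.toNNReal_coe] at he
    have h1 := Nat.lt_floor_add_one (p / δ)
    have h2 := Nat.floor_le (a := q / δ) zero_le
    rw [he] at h1
    have h3 : p / δ < q / δ + 1 := h1.trans_le (by gcongr)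
    rw [div_add_one hδ.ne', div_lt_div_iff_of_pos_right hδ] at h3
    exact_mod_cast h3.le
  let A : V → V × Finset V → ℕ × ℕ → Finset V := fun s c κ =>
    c.2.filter fun y => d s y ≤ D ∧ (r c.1 y, r s y) = κ
  -- For an empty class the chosen vertex is arbitrary; its pair is dropped below if the distance is
  -- infinite.
  have hmin : ∀ s c κ, ∃ x, (A s c κ).Nonempty → x ∈ A s c κ ∧ ∀ y ∈ A s c κ, d c.1 x ≤ d c.1 y := by
    intro s c κ
    by_cases hne : (A s c κ).Nonempty
    · obtain ⟨x, hx, h⟩ := Finset.exists_min_image _ (d c.1) hne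
      exact ⟨x, fun _ => ⟨hx, h⟩⟩
    · exact ⟨s, fun h => (hne h).elim⟩
  choose π hπ using hmin
  let R := Finset.range (⌊D / δ⌋₊ + 1)
  have hR : ∀ {a b}, d a b ≤ D → r a b ∈ R := by
    intro a b h
    simp only [r, R, Finset.mem_range]
    refine Nat.lt_succ_of_le (Nat.floor_mono ?_)
    gcongr
    simpa using ENNReal.toNNReal_mono ENNReal.coe_ne_top h
  refine ⟨((S ×ˢ P ×ˢ R ×ˢ R).image fun q => (q.1, π q.1 q.2.1 q.2.2)).filter
    fun p => d p.1 p.2 ≠ ∞, ?_, fun p hp => (Finset.mem_filter.1 hp).2, ?_⟩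
  · refine (Finset.card_filter_le _ _).trans (Finset.card_image_le.trans ?_)
    simp only [Finset.card_product, R, Finset.card_range]
    rw [sq, mul_assoc]
  · intro s hs c hc y hy hsy
    have hyA : y ∈ A s c (r c.1 y, r s y) := Finset.mem_filter.2 ⟨hy, hsy, rfl⟩
    obtain ⟨hx, hle⟩ := hπ s c (r c.1 y, r s y) ⟨y, hyA⟩
    set x := π s c (r c.1 y, r s y) with hxdef
    obtain ⟨hxc, hsx, hκ⟩ := Finset.mem_filter.1 hx
    obtain ⟨e1, e2⟩ := Prod.mk.inj hκ
    have hcx := (hP c hc).1 x hxc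
    have hcy := (hP c hc).1 y hy
    refine ⟨x, hxc, hle y hyA, ?_, hr hsx hsy e2, ?_⟩
    · refine Finset.mem_filter.2 ⟨Finset.mem_image.2 ⟨(s, c, r c.1 y, r s y), ?_, rfl⟩,
        ne_top_of_le_ne_top ENNReal.coe_ne_top hsx⟩
      simp only [Finset.mem_product]
      exact ⟨hs, hc, hR hcy, hR hsy⟩
    -- Along the chain `d x y` is the difference of the distances from the root, and these agree up
    -- to `δ`.
    · have h1 := (hP c hc).2 x hxc y hy (hle y hyA)
      have h2 := hr hcy hcx e1.symm
      rw [← h1] at h2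
      exact (ENNReal.add_le_add_iff_left (ne_top_of_le_ne_top ENNReal.coe_ne_top hcx)).1 h2

end Geodesic

/-! ### The hopset for a single scale -/

namespace WeightedDigraph

variable {V : Type u} (G : WeightedDigraph V)

theorem eq_of_dist_eq_zero [Fintype V] (hG : G.IsPositive) (x y : V) (h : G.dist x y = 0) :
    x = y := by
  by_contra hxy
  exact (G.dist_pos hG hxy).ne' h

namespace IsMinimalWalk

variable {G} {H : Set (WeightedEdge V)} {u v : V} {m : ℕ} {z : ℕ → V}

theorem ne (hz : G.IsMinimalWalk H u v m z) {i j : ℕ} (hij : i < j) (hj : j ≤ m) : z i ≠ z j := by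
  intro he
  have := (hz.2.2 i j hij.le hj).2.2.2 0 (by
    rw [he]
    exact ⟨0, le_rfl, 0, by simp, .nil _⟩)
  omega

theorem dist_le (hz : G.IsMinimalWalk H u v m z) {j : ℕ} (hj : j ≤ m) :
    G.dist u (z j) ≤ G.dist u v :=
  (hz.2.2 j j le_rfl hj).2.1 ▸ le_self_add

theorem dist_lt [Fintype V] (hG : G.IsPositive) (hd : G.dist u v ≠ ∞)
    (hz : G.IsMinimalWalk H u v m z) {i j : ℕ} (hij : i < j) (hj : j ≤ m) :
    G.dist u (z i) < G.dist u (z j) := by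
  rw [← (hz.2.2 i j hij.le hj).1]
  exact ENNReal.lt_add_right (ne_top_of_le_ne_top hd (hz.dist_le (hij.le.trans hj)))
    (G.dist_pos hG (hz.ne hij hj)).ne'

theorem injOn (hz : G.IsMinimalWalk H u v m z) : Set.InjOn z (Set.Iic m) := by
  intro i hi j hj he
  rcases lt_trichotomy i j with h | h | h
  · exact (hz.ne h hj he).elim
  · exact h
  · exact (hz.ne h hi he.symm).elim

theorem le_of_dist_le [Fintype V] (hG : G.IsPositive) (hd : G.dist u v ≠ ∞)
    (hz : G.IsMinimalWalk H u v m z) {i j : ℕ} (hi : i ≤ m)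
    (h : G.dist u (z i) ≤ G.dist u (z j)) : i ≤ j := by
  by_contra! hlt
  exact (hz.dist_lt hG hd hlt hi).not_ge h

theorem isGeodesicSet [Fintype V] [DecidableEq V] (hG : G.IsPositive) {D : ℝ≥0}
    (hd : G.dist u v ≤ D) (hz : G.IsMinimalWalk H u v m z) {I : Finset ℕ}
    (hI : ∀ i ∈ I, i ≤ m) : IsGeodesicSet G.dist D (u, I.image z) := by
  have hd' : G.dist u v ≠ ∞ := ne_top_of_le_ne_top ENNReal.coe_ne_top hd
  simp only [IsGeodesicSet, Finset.forall_mem_image]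
  exact ⟨fun i hi => (hz.dist_le (hI i hi)).trans hd, fun i hi j hj h =>
    (hz.2.2 i j (hz.le_of_dist_le hG hd' (hI i hi) h) (hI j hj)).1⟩

end IsMinimalWalk

/-- The hopset for one distance scale. -/
theorem exists_scale_hopset [Fintype V] [DecidableEq V] (hG : G.IsPositive) (hV : 2 ≤ Fintype.card V)
    {k t : ℕ} (hk : 0 < k) (hkt : k ≤ 2 ^ t) {D e : ℝ≥0} (hD : 0 < D) (he : 0 < e) :
    ∃ B : Finset (V × V), (∀ p ∈ B, G.dist p.1 p.2 ≠ ∞) ∧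
      (B.card : ℝ) ≤ 2 * Fintype.card V * t +
        (Fintype.card V / k * Real.log ((Fintype.card V : ℝ) ^ 2) + 1) *
        (2 * Fintype.card V / (k * √k) * Real.log ((Fintype.card V : ℝ) ^ 2) + 1) *
        (4 / e + 1) ^ 2 ∧
      ∀ u v, D ≤ G.dist u v → G.dist u v ≤ 2 * D →
        HasShortWalk (G.edges ∪ G.closureEdges B) (10 * k + 3) u v ((1 + e) * G.dist u v) := by
  classical
  set n := Fintype.card V with hn
  have hpos := G.eq_of_dist_eq_zero hG
  obtain ⟨P, hPgeo, hPk, hPcard, hPtouch⟩ := exists_chains G.dist hpos (2 * D) hk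
  choose B hB₁ hB₂ hB₃ using fun c : V × Finset V =>
    exists_two_step_pairs (β := ℝ≥0∞) (G.dist c.1) (Nat.clog 2 c.2.card) c.2
      (Nat.le_pow_clog one_lt_two _)
  set B₁ := P.biUnion B with hB₁def
  have hB₁fin : ∀ p ∈ B₁, G.dist p.1 p.2 ≠ ∞ := by
    intro p hp
    obtain ⟨c, hc, hpc⟩ := Finset.mem_biUnion.1 hp
    obtain ⟨h1, h2, h3⟩ := hB₂ c p hpc
    have h4 := (hPgeo c hc).2 _ h1 _ h2 h3
    exact ne_top_of_le_ne_top ENNReal.coe_ne_top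
      ((le_add_self.trans h4.le).trans ((hPgeo c hc).1 _ h2))
  have hB₁card : B₁.card ≤ 2 * n * t := by
    calc B₁.card ≤ ∑ c ∈ P, (B c).card := Finset.card_biUnion_le
      _ ≤ ∑ c ∈ P, t * k := Finset.sum_le_sum fun c hc => (hB₁ c).trans (by
          rw [hPk c hc]
          gcongr
          exact Nat.clog_le_of_le_pow hkt)
      _ = (P.card * k) * t := by rw [Finset.sum_const, smul_eq_mul]; ring
      _ ≤ _ := by gcongr
  have hH₁ := G.closureEdges_subset hB₁fin
  have hchain : ∀ c ∈ P, ∀ x ∈ c.2, ∀ y ∈ c.2, G.dist c.1 x < G.dist c.1 y →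
      HasShortWalk (G.closureEdges B₁) 2 x y (G.dist x y) := by
    intro c hc x hx y hy hxy
    obtain ⟨w, hw, h1, h2, h3, h4⟩ := hB₃ c x hx y hy hxy
    have hBB : B c ⊆ B₁ := Finset.subset_biUnion_of_mem B hc
    rw [← (hPgeo c hc).dist_add hx hy hw h1 h2]
    exact (G.hasShortWalk_closureEdges (hBB h3)).trans (G.hasShortWalk_closureEdges (hBB h4))
  have hwalk : ∀ q : V × V, ∃ (m : ℕ) (z : ℕ → V), G.dist q.1 q.2 ≠ ∞ →
      G.IsMinimalWalk (G.closureEdges B₁) q.1 q.2 m z := by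
    intro q
    by_cases hd : G.dist q.1 q.2 = ∞
    · exact ⟨0, fun _ => q.1, fun h => (h hd).elim⟩
    · obtain ⟨m, z, h⟩ := G.exists_isMinimalWalk hH₁ hd
      exact ⟨m, z, fun _ => h⟩
  choose m z hz using hwalk
  -- The pairs that the chain shortcuts alone do not serve.
  let I : Finset (V × V) := Finset.univ.filter fun q =>
    G.dist q.1 q.2 ≤ (2 * D : ℝ≥0) ∧ 10 * k + 3 < m q
  have hI : ∀ q ∈ I, G.dist q.1 q.2 ≤ (2 * D : ℝ≥0) ∧ 10 * k + 3 < m q ∧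
      G.IsMinimalWalk (G.closureEdges B₁) q.1 q.2 (m q) (z q) := by
    intro q hq
    obtain ⟨h1, h2⟩ := (Finset.mem_filter.1 hq).2
    exact ⟨h1, h2, hz q (ne_top_of_le_ne_top ENNReal.coe_ne_top h1)⟩
  have hIcard : (I.card : ℝ) ≤ (n : ℝ) ^ 2 := by
    have : I.card ≤ n ^ 2 := (Finset.card_le_univ _).trans (by rw [Fintype.card_prod, sq])
    exact_mod_cast this
  have hN : (1 : ℝ) ≤ (n : ℝ) ^ 2 := by
    have : (2 : ℝ) ≤ n := by exact_mod_cast hV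
    nlinarith
  have hk0 : (0 : ℝ) < k := by exact_mod_cast hk
  -- `S` meets the first `k` vertices of each long walk.
  obtain ⟨S, -, hScard, hS⟩ := exists_hitting_set Finset.univ I
    (fun q => (Finset.range k).image (z q)) (fun _ _ => Finset.subset_univ _) hk0 (by
      intro q hq
      obtain ⟨h1, h2, h3⟩ := hI q hq
      rw [Finset.card_image_of_injOn (h3.injOn.mono fun i hi => ?_), Finset.card_range]
      simp only [Finset.coe_range, Set.mem_Iio] at hi
      exact Set.mem_Iic.2 (by omega)) hN hIcard
  -- Every third vertex near the end of the walk. The spacing exceeds the two hops of a shortcut, so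
  -- a chain leading forward between two of these would contradict minimality.
  let Y : V × V → Finset V := fun q =>
    ((Finset.range (3 * k)).image fun i => m q - 3 * i).image (z q)
  have hYidx : ∀ q ∈ I, ∀ j ∈ ((Finset.range (3 * k)).image fun i => m q - 3 * i), j ≤ m q := by
    intro q hq j hj
    obtain ⟨i, -, rfl⟩ := Finset.mem_image.1 hj
    omega
  obtain ⟨P', hP'P, hP'card, hP'⟩ := exists_hitting_set P I
    (fun q => P.filter fun c => ¬ Disjoint c.2 (Y q)) (fun _ _ => Finset.filter_subset _ _)
    (Real.sqrt_pos.2 hk0) (by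
      intro q hq
      obtain ⟨h1, h2, h3⟩ := hI q hq
      have := hPtouch q.1 (Y q) (h3.isGeodesicSet hG h1 (hYidx q hq)) (by
        rw [Finset.card_image_of_injOn (h3.injOn.mono fun j hj => hYidx q hq j hj),
          Finset.card_image_of_injOn, Finset.card_range]
        intro i hi j hj hij
        simp only [Finset.coe_range, Set.mem_Iio] at hi hj hij
        omega) (by
        simp only [Y, Finset.forall_mem_image, Finset.mem_range]
        rintro i hi j hj hlt ⟨c, hc, hx, hy, hxy⟩
        have hij : m q - 3 * i < m q - 3 * j := by
          have h5 := h3.le_of_dist_le hG (ne_top_of_le_ne_top ENNReal.coe_ne_top h1) (by omega)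
            hlt.le
          refine lt_of_le_of_ne h5 fun he => ?_
          rw [he] at hlt
          exact lt_irrefl _ hlt
        have h6 := (h3.2.2 _ _ hij.le (by omega)).2.2.2 2
          ((hchain c hc _ hx _ hy hxy).mono Set.subset_union_right le_rfl le_rfl)
        omega)
      exact Real.sqrt_le_iff.2 ⟨by positivity, by exact_mod_cast this⟩) hN hIcard
  -- A portal costs at most `2δ = eD ≤ e * G.dist u v`, and there are at most `2D/δ + 1 = 4/e + 1`
  -- rounded values.
  set δ : ℝ≥0 := e * D / 2 with hδdef
  have hδ : 0 < δ := by positivity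
  obtain ⟨B₂, hB₂card, hB₂fin, hB₂portal⟩ := exists_portals G.dist (2 * D) δ hδ S P'
    fun c hc => hPgeo c (hP'P hc)
  refine ⟨B₁ ∪ B₂, fun p hp => (Finset.mem_union.1 hp).elim (hB₁fin p) (hB₂fin p), ?_, ?_⟩
  · have h1 : ((B₁ ∪ B₂).card : ℝ) ≤ B₁.card + B₂.card := by
      exact_mod_cast Finset.card_union_le B₁ B₂
    have h2 : (B₁.card : ℝ) ≤ 2 * n * t := by exact_mod_cast hB₁card
    have h3 : (B₂.card : ℝ) ≤ S.card * P'.card * (⌊2 * D / δ⌋₊ + 1) ^ 2 := by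
      exact_mod_cast hB₂card
    have h4 : (⌊2 * D / δ⌋₊ : ℝ) ≤ 4 / e := by
      have h5 : 2 * D / δ = 4 / e := by
        rw [hδdef]
        field_simp
        norm_num
      rw [h5]
      exact_mod_cast Nat.floor_le (a := 4 / e) zero_le
    have hlog := Real.log_nonneg hN
    have h7 : (P.card : ℝ) ≤ 2 * n / k := by
      rw [le_div_iff₀ hk0]
      exact_mod_cast hPcard
    refine h1.trans (add_le_add h2 (h3.trans ?_))
    gcongr
    · exact hScard
    · refine hP'card.trans ?_
      rw [← div_div]
      gcongr
  · intro u v hDu huD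
    have hd : G.dist u v ≠ ∞ := ne_top_of_le_ne_top (by finiteness) huD
    have hsub₁ : (G.closureEdges B₁ : Set (WeightedEdge V)) ⊆ G.closureEdges (B₁ ∪ B₂) :=
      Finset.coe_subset.2 (Finset.image_subset_image Finset.subset_union_left)
    have hsub₂ : (G.closureEdges B₂ : Set (WeightedEdge V)) ⊆ G.closureEdges (B₁ ∪ B₂) :=
      Finset.coe_subset.2 (Finset.image_subset_image Finset.subset_union_right)
    have hsub₁' := Set.union_subset_union_right G.edges hsub₁
    have hzq := hz (u, v) hd
    have hone : G.dist u v ≤ (1 + e) * G.dist u v := by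
      rw [add_mul, one_mul]
      exact le_self_add
    by_cases hm : m (u, v) ≤ 10 * k + 3
    · have h1 := (hzq.2.2 0 _ (Nat.zero_le _) le_rfl).2.2.1
      rw [hzq.1, hzq.2.1] at h1
      exact h1.mono hsub₁' (by omega) hone
    have hq : (u, v) ∈ I := Finset.mem_filter.2
      ⟨Finset.mem_univ _, by simpa using huD, not_le.1 hm⟩
    obtain ⟨s, hs, hsS⟩ := Finset.not_disjoint_iff.1 (hS _ hq)
    obtain ⟨i, hi, rfl⟩ := Finset.mem_image.1 hs
    obtain ⟨c, hc, hcP'⟩ := Finset.not_disjoint_iff.1 (hP' _ hq)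
    obtain ⟨hcP, hcY⟩ := Finset.mem_filter.1 hc
    obtain ⟨y, hyc, hy⟩ := Finset.not_disjoint_iff.1 hcY
    simp only [Y, Finset.mem_image, Finset.mem_range] at hi hy
    obtain ⟨_, ⟨i', hi', rfl⟩, rfl⟩ := hy
    set j := m (u, v) - 3 * i' with hj
    set s := z (u, v) i
    set y := z (u, v) j
    -- More than `10 * k + 3` hops separate the ends, while `i < k` and `y` lies fewer than `9 * k`
    -- hops before the end.
    have hij : i ≤ j := by omega
    have hjm : j ≤ m (u, v) := by omega
    obtain ⟨a1, a2, -, -⟩ := hzq.2.2 i j hij hjm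
    have w1 := (hzq.2.2 0 i (Nat.zero_le _) (hij.trans hjm)).2.2.1
    have w3 := (hzq.2.2 j _ hjm le_rfl).2.2.1
    rw [hzq.1] at w1
    rw [hzq.2.1] at w3
    have hsy : G.dist s y ≤ (2 * D : ℝ≥0) := by
      refine le_trans ?_ (huD.trans (by simp))
      rw [← a2, ← a1, add_assoc]
      exact le_add_left le_self_add
    obtain ⟨x, hxc, hxy, hxB, hsx, hxyδ⟩ := hB₂portal _ hsS c hcP' y hyc hsy
    have w2 : HasShortWalk (G.edges ∪ G.closureEdges (B₁ ∪ B₂)) 2 x y (G.dist x y) := by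
      -- Equal distances from the root mean `x = y`, and no hop is needed.
      rcases hxy.lt_or_eq with h | h
      · exact (hchain c hcP x hxc y hyc h).mono (hsub₁.trans Set.subset_union_right) le_rfl le_rfl
      · rw [(hPgeo c hcP).injOn hpos x hxc y hyc h]
        exact ⟨0, by omega, 0, by simp, .nil _⟩
    have w0 : HasShortWalk (G.edges ∪ G.closureEdges (B₁ ∪ B₂)) 1 s x (G.dist s x) :=
      (G.hasShortWalk_closureEdges hxB).mono (hsub₂.trans Set.subset_union_right) le_rfl le_rfl
    -- At most `(k - 1) + 1 + 2 + (9k - 3)` hops.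
    refine (((w1.mono hsub₁' le_rfl le_rfl).trans w0).trans w2 |>.trans
      (w3.mono hsub₁' le_rfl le_rfl)).mono subset_rfl (by omega) ?_
    calc G.dist u s + G.dist s x + G.dist x y + G.dist y v
        ≤ G.dist u s + (G.dist s y + δ) + δ + G.dist y v := by gcongr
      _ = G.dist u s + G.dist s y + G.dist y v + (δ + δ) := by ring
      _ = G.dist u v + e * D := by
        rw [a1, a2, ← ENNReal.coe_add, hδdef, add_halves, ENNReal.coe_mul]
      _ ≤ G.dist u v + e * G.dist u v := by gcongr
      _ = (1 + e) * G.dist u v := by ring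

end WeightedDigraph

/-! ### Size of one scale for `k ≈ n^(2/5)/13` -/

theorem scale_size_le {n : ℕ} (hn : 2 ≤ n) (hβ : 13 ≤ (n : ℝ) ^ (2 / 5 : ℝ)) {k : ℕ}
    (hk : k = ⌊(n : ℝ) ^ (2 / 5 : ℝ) / 13⌋₊) {ε : ℝ} (h0 : 0 < ε) (h1 : ε < 1) :
    2 * n * (Nat.log 2 n + 1 : ℕ) + (n / k * Real.log ((n : ℝ) ^ 2) + 1) *
        (2 * n / (k * √k) * Real.log ((n : ℝ) ^ 2) + 1) * (4 / ε + 1) ^ 2 ≤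
      811204 * (1 + Real.log n) ^ 2 * (n * (1 / ε ^ 2)) := by
  have hn1 : (1 : ℝ) ≤ n := by exact_mod_cast (by omega : 1 ≤ n)
  -- With `b = n^(1/5)`, `k` lies between `b²/26` and `b²/13` and `√k` is at least `b/6`, so all
  -- estimates become polynomial in `b`.
  set b : ℝ := (n : ℝ) ^ (1 / 5 : ℝ) with hb
  have hb1 : 1 ≤ b := Real.one_le_rpow hn1 (by norm_num)
  have hb2 : (n : ℝ) ^ (2 / 5 : ℝ) = b ^ 2 := by
    rw [hb, ← Real.rpow_natCast, ← Real.rpow_mul (by linarith)]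
    norm_num
  have hb5 : (n : ℝ) = b ^ 5 := by
    rw [hb, ← Real.rpow_natCast, ← Real.rpow_mul (by linarith)]
    norm_num
  rw [hb2] at hk hβ
  have hk1 : (k : ℝ) ≤ b ^ 2 / 13 := by
    rw [hk]
    exact Nat.floor_le (by positivity)
  have hk2 : b ^ 2 / 26 ≤ k := by
    have h2 := Nat.lt_floor_add_one (b ^ 2 / 13)
    rw [← hk] at h2
    have h3 : (1 : ℝ) ≤ k := by
      rw [hk]
      exact_mod_cast Nat.floor_pos.2 (by linarith)
    linarith
  have hs1 : √(k : ℝ) ≤ b := Real.sqrt_le_iff.2 ⟨by linarith, by nlinarith⟩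
  have hs2 : b / 6 ≤ √(k : ℝ) := Real.le_sqrt_of_sq_le (by nlinarith)
  have hk0 : (0 : ℝ) < k := by nlinarith
  have hs0 : 0 < √(k : ℝ) := by positivity
  have hl : 0 ≤ Real.log n := Real.log_nonneg hn1
  rw [Real.log_pow]
  push_cast
  set l := Real.log n with hldef
  have ht : (Nat.log 2 n : ℝ) ≤ 2 * l := by
    have h2 : ((2 ^ Nat.log 2 n : ℕ) : ℝ) ≤ n := by exact_mod_cast Nat.pow_log_le_self 2 (by omega)
    have h3 := Real.log_le_log (by positivity) h2
    rw [Nat.cast_pow, Real.log_pow] at h3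
    have h4 := Real.log_two_gt_d9
    push_cast at h3
    have h5 : (0 : ℝ) ≤ Nat.log 2 n := by positivity
    nlinarith
  have hb3 : b ^ 3 ≤ b ^ 5 := pow_le_pow_right₀ hb1 (by norm_num)
  have hb23 : b ^ 2 ≤ b ^ 5 := pow_le_pow_right₀ hb1 (by norm_num)
  have hA : 1 ≤ n / (k : ℝ) := by
    rw [one_le_div hk0, hb5]
    nlinarith
  have hA' : 1 ≤ 2 * n / (k * √(k : ℝ)) := by
    rw [one_le_div (by positivity), hb5]
    calc k * √(k : ℝ) ≤ b ^ 2 * b := by gcongr; nlinarith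
      _ ≤ 2 * b ^ 5 := by nlinarith
  have e1 : n / (k : ℝ) * (2 * l) + 1 ≤ 2 * (n / k) * (1 + l) := by nlinarith
  have e2 : 2 * n / (k * √(k : ℝ)) * (2 * l) + 1 ≤ 2 * (2 * n / (k * √(k : ℝ))) * (1 + l) := by
    nlinarith
  have e3 : (4 / ε + 1) ^ 2 ≤ 25 * (1 / ε ^ 2) := by
    rw [show 25 * (1 / ε ^ 2) = (5 / ε) ^ 2 by ring]
    gcongr
    rw [div_add_one h0.ne']
    gcongr
    linarith
  -- The balance behind the exponent: `k^(5/2)` is of order `b⁵ = n`, with `4056 = 26 · 26 · 6`.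
  have e4 : n / (k : ℝ) * (2 * n / (k * √(k : ℝ))) ≤ 8112 * n := by
    have h2 : b ^ 5 / 4056 ≤ k * (k * √(k : ℝ)) := by
      calc b ^ 5 / 4056 = b ^ 2 / 26 * (b ^ 2 / 26 * (b / 6)) := by ring
        _ ≤ _ := by gcongr
    rw [← hb5] at h2
    rw [div_mul_div_comm, div_le_iff₀ (by positivity)]
    nlinarith
  have e5 : 1 ≤ 1 / ε ^ 2 := by
    rw [one_le_div (by positivity)]
    nlinarith
  have hn0 : (0 : ℝ) ≤ n := by linarith
  have e6 : 2 * n * ((Nat.log 2 n : ℝ) + 1) ≤ 4 * (1 + l) ^ 2 * (n * (1 / ε ^ 2)) := by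
    calc 2 * n * ((Nat.log 2 n : ℝ) + 1) ≤ 2 * n * (2 * (1 + l) ^ 2) := by
          gcongr
          nlinarith
      _ = 4 * (1 + l) ^ 2 * (n * 1) := by ring
      _ ≤ _ := by gcongr
  calc _ ≤ 4 * (1 + l) ^ 2 * (n * (1 / ε ^ 2)) + 2 * (n / k) * (1 + l) *
          (2 * (2 * n / (k * √(k : ℝ))) * (1 + l)) * (25 * (1 / ε ^ 2)) := by gcongr
    _ = 4 * (1 + l) ^ 2 * (n * (1 / ε ^ 2)) + 100 * (1 + l) ^ 2 * (1 / ε ^ 2) *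
          (n / (k : ℝ) * (2 * n / (k * √(k : ℝ)))) := by ring
    _ ≤ 4 * (1 + l) ^ 2 * (n * (1 / ε ^ 2)) + 100 * (1 + l) ^ 2 * (1 / ε ^ 2) *
          (8112 * n) := by gcongr
    _ = _ := by ring

/-! ### Union over the scales -/

namespace WeightedDigraph

variable {V : Type u} (G : WeightedDigraph V)

/-- A shortest walk between distinct vertices has at least one and fewer than `n` edges, so its
length lies in `[lo, n * hi]`, which `L` dyadic intervals cover. -/
theorem exists_scale [Fintype V] {lo hi : ℝ≥0}
    (hw : ∀ e ∈ G.edges, lo ≤ e.2.2 ∧ e.2.2 ≤ hi) {L : ℕ} (hL : Fintype.card V * hi ≤ lo * 2 ^ L)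
    (hL0 : 0 < L) {u v : V} (huv : u ≠ v) (hd : G.dist u v ≠ ∞) :
    ∃ i < L, ((lo * 2 ^ i : ℝ≥0) : ℝ≥0∞) ≤ G.dist u v ∧
      G.dist u v ≤ 2 * (lo * 2 ^ i : ℝ≥0) := by
  obtain ⟨h, hh, a, p, ha⟩ := exists_isWalk_eq_walkDist G.finite_edges hd
  have h1 : lo ≤ a := p.le_length (fun e he => (hw e he).1) huv
  have h2 : a ≤ lo * 2 ^ L := by
    refine (p.length_le fun e he => (hw e he).2).trans (hL.trans' ?_)
    gcongr
  rw [dist, ← ha]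
  clear ha p hL
  induction L with
  | zero => omega
  | succ L ih =>
    rcases Nat.eq_zero_or_pos L with rfl | hL
    · refine ⟨0, by omega, ?_, ?_⟩
      · simpa using h1
      · rw [zero_add, pow_one, mul_comm] at h2
        simpa using (by exact_mod_cast h2 : (a : ℝ≥0∞) ≤ 2 * lo)
    · rcases le_total a (lo * 2 ^ L) with h | h
      · obtain ⟨i, hi, h3⟩ := ih hL h
        exact ⟨i, by omega, h3⟩
      · refine ⟨L, by omega, by exact_mod_cast h, ?_⟩
        rw [pow_succ, ← mul_assoc, mul_comm] at h2
        exact_mod_cast h2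

theorem isHopset_of_hasShortWalk [Fintype V] {H : Set (WeightedEdge V)} (hH : H ⊆ G.closure)
    {β ε : ℝ} (hε : 0 ≤ ε) (hβ : 0 ≤ β) {h : ℕ} (hh : (h : ℝ) ≤ β)
    (hw : ∀ u v, u ≠ v → G.dist u v ≠ ∞ →
      HasShortWalk (G.edges ∪ H) h u v ((1 + ε.toNNReal) * G.dist u v)) : G.IsHopset β ε H := by
  refine fun u v => ⟨G.dist_le_hopDist hH β u v, ?_⟩
  have he : ENNReal.ofReal (1 + ε) = 1 + ε.toNNReal := by
    rw [ENNReal.ofReal_add zero_le_one hε, ENNReal.ofReal_one]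
    rfl
  rw [he]
  rcases eq_or_ne u v with rfl | huv
  · exact HasShortWalk.hopDist_le (h := 0) ⟨0, le_rfl, 0, by simp, .nil _⟩ (by simpa using hβ)
  by_cases hd : G.dist u v = ∞
  · rw [hd, ENNReal.mul_top (by simp)]
    exact le_top
  · exact (hw u v huv hd).hopDist_le hh

theorem exists_hopset_of_weights_mem_Icc [Fintype V] (hG : G.IsPositive) (hV : 2 ≤ Fintype.card V)
    {k : ℕ} (hk : 0 < k) (hkn : k ≤ Fintype.card V) {ε : ℝ} (hε : 0 < ε) {β : ℝ}
    (hβ : (10 * k + 3 : ℝ) ≤ β) {lo hi : ℝ≥0} (hlo : 0 < lo)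
    (hw : ∀ e ∈ G.edges, lo ≤ e.2.2 ∧ e.2.2 ≤ hi) {L : ℕ} (hL : Fintype.card V * hi ≤ lo * 2 ^ L)
    (hL0 : 0 < L) :
    ∃ H : Finset (WeightedEdge V), (H : Set (WeightedEdge V)) ⊆ G.closure ∧
      (H.card : ℝ) ≤ L * (2 * Fintype.card V * (Nat.log 2 (Fintype.card V) + 1 : ℕ) +
        (Fintype.card V / k * Real.log ((Fintype.card V : ℝ) ^ 2) + 1) *
        (2 * Fintype.card V / (k * √k) * Real.log ((Fintype.card V : ℝ) ^ 2) + 1) *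
        (4 / ε + 1) ^ 2) ∧
      G.IsHopset β ε (H : Set (WeightedEdge V)) := by
  classical
  choose B hBfin hBcard hBwalk using fun i : ℕ => G.exists_scale_hopset hG hV hk
    (hkn.trans (Nat.lt_pow_succ_log_self one_lt_two _).le) (D := lo * 2 ^ i) (by positivity)
    (Real.toNNReal_pos.2 hε)
  simp only [Real.coe_toNNReal _ hε.le] at hBcard
  have hcl : (G.closureEdges ((Finset.range L).biUnion B) : Set (WeightedEdge V)) ⊆ G.closure := by
    refine G.closureEdges_subset fun p hp => ?_
    obtain ⟨i, -, hi⟩ := Finset.mem_biUnion.1 hp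
    exact hBfin i p hi
  refine ⟨G.closureEdges ((Finset.range L).biUnion B), hcl, ?_, ?_⟩
  · have h1 : (G.closureEdges ((Finset.range L).biUnion B)).card ≤
        ∑ i ∈ Finset.range L, (B i).card := Finset.card_image_le.trans Finset.card_biUnion_le
    refine (Nat.cast_le.2 h1).trans ?_
    push_cast
    refine (Finset.sum_le_card_nsmul _ _ _ fun i _ => hBcard i).trans ?_
    rw [nsmul_eq_mul, Finset.card_range, Nat.succ_eq_add_one]
    push_cast
    exact le_rfl
  · refine G.isHopset_of_hasShortWalk hcl hε.le (le_trans (by positivity) hβ) (h := 10 * k + 3)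
      (by exact_mod_cast hβ) fun u v huv hd => ?_
    obtain ⟨i, hi, h1, h2⟩ := G.exists_scale hw hL hL0 huv hd
    refine (hBwalk i u v h1 h2).mono (Set.union_subset_union_right _ ?_) le_rfl le_rfl
    exact Finset.coe_subset.2 (Finset.image_subset_image
      (Finset.subset_biUnion_of_mem B (Finset.mem_range.2 hi)))

/-- The whole transitive closure is a hopset. -/
theorem exists_hopset_card_le_sq [Fintype V] {ε β : ℝ} (hε : 0 ≤ ε) (hβ : 1 ≤ β) :
    ∃ H : Finset (WeightedEdge V), (H : Set (WeightedEdge V)) ⊆ G.closure ∧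
      H.card ≤ Fintype.card V ^ 2 ∧ G.IsHopset β ε (H : Set (WeightedEdge V)) := by
  classical
  have hcl := G.closureEdges_subset (B := Finset.univ.filter fun p => G.dist p.1 p.2 ≠ ∞)
    fun p hp => (Finset.mem_filter.1 hp).2
  refine ⟨_, hcl, ?_, G.isHopset_of_hasShortWalk hcl hε (by linarith) (h := 1) (by simpa using hβ)
    fun u v _ hd => ?_⟩
  · refine Finset.card_image_le.trans ((Finset.card_le_univ _).trans ?_)
    rw [Fintype.card_prod, sq]
  · refine (G.hasShortWalk_closureEdges (Finset.mem_filter.2 ⟨Finset.mem_univ (u, v), hd⟩)).mono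
      Set.subset_union_right le_rfl ?_
    rw [add_mul, one_mul]
    exact le_self_add

end WeightedDigraph

theorem mainTheorem5 :
    ∃ (C : ℝ) (k : ℕ), 0 < C ∧
      ∀ (V : Type u) [Fintype V] (G : WeightedDigraph V) (W ε : ℝ),
        G.IsPositive → 1 ≤ W → G.WeightRatioLE W → 0 < ε → ε < 1 →
        ∃ H : Finset (WeightedEdge V),
          (H : Set (WeightedEdge V)) ⊆ G.closure ∧
          (H.card : ℝ) ≤ C * (1 + Real.log (Fintype.card V)) ^ k *
            ((Fintype.card V : ℝ) * (1 / ε ^ 2) * Real.log ((Fintype.card V : ℝ) * W)) ∧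
          G.IsHopset ((Fintype.card V : ℝ) ^ (2 / 5 : ℝ)) ε (H : Set (WeightedEdge V)) := by
  -- For large `n` the constant needed is `6 · 811204 = 4867224`; for small `n`, `n² ≤ 2500000 n`
  -- suffices because `log (nW) ≥ 1/2`.
  refine ⟨5000000, 2, by norm_num, fun V _ G W ε hG hW hGW hε hε1 => ?_⟩
  set n := Fintype.card V with hn
  have hβ0 : (0 : ℝ) ≤ (n : ℝ) ^ (2 / 5 : ℝ) := by positivity
  have hempty : 0 ≤ Real.log (n * W) → (∀ u v, u ≠ v → G.dist u v = ∞) →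
      ∃ H : Finset (WeightedEdge V),
          (H : Set (WeightedEdge V)) ⊆ G.closure ∧
          (H.card : ℝ) ≤ 5000000 * (1 + Real.log n) ^ 2 *
            ((n : ℝ) * (1 / ε ^ 2) * Real.log (n * W)) ∧
          G.IsHopset ((n : ℝ) ^ (2 / 5 : ℝ)) ε (H : Set (WeightedEdge V)) := by
    intro hlog hd
    refine ⟨∅, by simp, by simp; positivity, G.isHopset_of_hasShortWalk (by simp) hε.le hβ0
      (h := 0) (by simpa using hβ0) fun u v huv h => (h (hd u v huv)).elim⟩
  rcases Nat.lt_or_ge n 2 with hn2 | hn2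
  · refine hempty ?_ fun u v huv => ?_
    -- For `n = 0` the convention `Real.log 0 = 0` applies.
    · interval_cases n
      · simp
      · simpa using Real.log_nonneg hW
    · exact (huv (Fintype.card_le_one_iff.1 (by omega) u v)).elim
  have hn2' : (2 : ℝ) ≤ n := by exact_mod_cast hn2
  have hl : 0 ≤ Real.log n := Real.log_nonneg (by linarith)
  have hlog2 := Real.log_two_gt_d9
  have hnW : 1 / 2 ≤ Real.log (n * W) := by
    have : Real.log 2 ≤ Real.log (n * W) := Real.log_le_log (by norm_num) (by nlinarith)
    linarith
  have hε2 : 1 ≤ 1 / ε ^ 2 := by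
    rw [one_le_div (by positivity)]
    nlinarith
  by_cases hβ : 13 ≤ (n : ℝ) ^ (2 / 5 : ℝ)
  swap
  -- Here `k` would be zero, but `n` is bounded and the whole closure is small enough.
  · obtain ⟨H, hHcl, hHcard, hH⟩ := G.exists_hopset_card_le_sq hε.le
      (Real.one_le_rpow (by linarith : (1 : ℝ) ≤ n) (by norm_num : (0 : ℝ) ≤ 2 / 5))
    refine ⟨H, hHcl, ?_, hH⟩
    have hn13 : (n : ℝ) ≤ 13 ^ 3 := by
      rw [not_le] at hβ
      calc (n : ℝ) = ((n : ℝ) ^ (2 / 5 : ℝ)) ^ (5 / 2 : ℝ) := by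
            rw [← Real.rpow_mul (by linarith)]
            norm_num
        _ ≤ 13 ^ (5 / 2 : ℝ) := by gcongr
        _ ≤ 13 ^ (3 : ℝ) := Real.rpow_le_rpow_of_exponent_le (by norm_num) (by norm_num)
        _ = 13 ^ 3 := by norm_num
    calc (H.card : ℝ) ≤ (n : ℝ) ^ 2 := by exact_mod_cast hHcard
      _ ≤ 5000000 * 1 ^ 2 * (n * 1 * (1 / 2)) := by nlinarith
      _ ≤ _ := by
        gcongr
        linarith
  by_cases hedge : ∃ x y, G.Adj x y
  swap
  · refine hempty (by linarith) fun u v huv => ?_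
    by_contra hd
    obtain ⟨h, -, a, p, -⟩ := exists_isWalk_eq_walkDist G.finite_edges hd
    cases p with
    | nil => exact huv rfl
    | cons he _ => exact hedge ⟨_, _, he.1⟩
  obtain ⟨x, y, hxy⟩ := hedge
  -- For `k ≥ 1` the hop count `10 * k + 3 ≤ 13 * k` stays within `n^(2/5)`.
  set k := ⌊(n : ℝ) ^ (2 / 5 : ℝ) / 13⌋₊ with hk
  have hkle : (k : ℝ) ≤ (n : ℝ) ^ (2 / 5 : ℝ) / 13 := Nat.floor_le (by positivity)
  have hk1 : 0 < k := Nat.floor_pos.2 (by linarith)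
  have hk1' : (1 : ℝ) ≤ k := by exact_mod_cast hk1
  have hkn : k ≤ n := by
    have : (n : ℝ) ^ (2 / 5 : ℝ) ≤ (n : ℝ) ^ (1 : ℝ) :=
      Real.rpow_le_rpow_of_exponent_le (by linarith) (by norm_num)
    rw [Real.rpow_one] at this
    exact_mod_cast (by linarith : (k : ℝ) ≤ n)
  set w := G.weight x y with hwdef
  have hw0 : 0 < w := hG x y hxy
  lift W to ℝ≥0 using by linarith
  have hW0 : 0 < W := lt_of_lt_of_le one_pos (by exact_mod_cast hW)
  have hW0' : (0 : ℝ) < W := hW0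
  -- All weights lie in `[w / W, W * w]` for the weight `w` of any one edge, so distances span a
  -- ratio of at most `X`.
  set X : ℝ := n * (W : ℝ) ^ 2 with hX
  have hX0 : 0 < X := by positivity
  set L := ⌊Real.log X / Real.log 2⌋₊ + 1 with hL
  have hXL : X ≤ 2 ^ L := by
    have h1 := Nat.lt_floor_add_one (Real.log X / Real.log 2)
    rw [div_lt_iff₀ (by linarith)] at h1
    refine (Real.log_le_log_iff hX0 (by positivity)).1 ?_
    rw [Real.log_pow, hL]
    push_cast
    exact h1.le
  have hLcard : (L : ℝ) ≤ 6 * Real.log (n * W) := by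
    have hW1 : 0 ≤ Real.log W := Real.log_nonneg hW
    have h1 : Real.log X ≤ 2 * Real.log (n * W) := by
      rw [hX, Real.log_mul (by positivity) (by positivity), Real.log_mul (by positivity)
        (by positivity), Real.log_pow]
      push_cast
      linarith
    have hX1 : 0 ≤ Real.log X := by
      rw [hX, Real.log_mul (by positivity) (by positivity), Real.log_pow]
      positivity
    have h2 : (L : ℝ) ≤ Real.log X / Real.log 2 + 1 := by
      rw [hL]
      push_cast
      gcongr
      exact Nat.floor_le (div_nonneg hX1 (by linarith))
    have h3 : Real.log X / Real.log 2 ≤ 2 * Real.log X := by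
      rw [div_le_iff₀ (by linarith)]
      nlinarith
    linarith
  obtain ⟨H, hHcl, hHcard, hH⟩ := G.exists_hopset_of_weights_mem_Icc hG hn2 hk1 hkn hε
    (β := (n : ℝ) ^ (2 / 5 : ℝ)) (by linarith) (lo := w / W) (hi := W * w) (L := L)
    (by positivity) (by
      rintro ⟨a, b, c⟩ ⟨hab, hc⟩
      simp only at hab hc
      subst hc
      refine ⟨?_, by exact_mod_cast hGW _ _ _ _ hab hxy⟩
      rw [div_le_iff₀ hW0, mul_comm]
      exact_mod_cast hGW _ _ _ _ hxy hab) (by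
      have h1 : n * W ^ 2 ≤ 2 ^ L := by exact_mod_cast hXL
      calc n * (W * w) = w / W * (n * W ^ 2) := by field_simp
        _ ≤ _ := by gcongr) (by omega)
  refine ⟨H, hHcl, hHcard.trans ?_, hH⟩
  have hsize := scale_size_le hn2 hβ hk hε hε1
  have hlogsq : 0 ≤ Real.log ((n : ℝ) ^ 2) := by
    rw [Real.log_pow]
    positivity
  calc _ ≤ 6 * Real.log (n * W) * (811204 * (1 + Real.log n) ^ 2 * (n * (1 / ε ^ 2))) :=
        mul_le_mul hLcard hsize (by positivity) (by linarith)
    _ = 4867224 * (1 + Real.log n) ^ 2 * (n * (1 / ε ^ 2) * Real.log (n * W)) := by ring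
    _ ≤ _ := by
      gcongr
      norm_num
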